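/- For $n\ge 1$ identify $\mathbb{F}_2^{2n}$ with $\mathbb{F}_2^n\times\mathbb{F}_2^n$ and let $\mathcal{M}_{2n}$ (the Maiorana--McFarland class) be the set of all Boolean functions $f:\mathbb{F}_2^{2n}\to\mathbb{F}_2$ of the form $$f(x,y)=\langle x,\pi(y)\rangle\oplus\varphi(y),\qquad x,y\in\mathbb{F}_2^n,$$ where $\pi$ is a permutation of $\mathbb{F}_2^n$, $\varphi:\mathbb{F}_2^n\to\mathbb{F}_2$ is an arbitrary function, and $\langle x,z\rangle=x_1z_1\oplus\dots\oplus x_nz_n$. For $f:\mathbb{F}_2^{2n}\to\mathbb{F}_2$ put $$\mathcal{N}(f)=\{f\oplus \mathbf{1}_U : U \text{ is an } n\text{-dimensional affine subspace of } \mathbb{F}_2^{2n} \text{ and } f|_U \text{ is affine}\},$$ where $\mathbf{1}_U$ is the characteristic function of $U$ and $f|_U$ is called affine if it is the restriction to $U$ of an affine function $\mathbb{F}_2^{2n}\to\mathbb{F}_2$. Let $$\mathcal{M}^{sp}_{2n}=\bigcup_{f\in\mathcal{M}_{2n}}\mathcal{N}(f),\qquad \mathcal{N}(\mathcal{M}_{2n})=\Big(\bigcup_{f\in\mathcal{M}_{2n}}\mathcal{N}(f)\Big)\setminus\mathcal{M}_{2n}.$$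 Then, as $n\to\infty$, $$|\mathcal{N}(\mathcal{M}_{2n})|=\Big(\tfrac{1}{18}\,2^{2n}+\tfrac{367}{63}\Big)|\mathcal{M}_{2n}|+o(|\mathcal{M}_{2n}|)$$ and $$|\mathcal{M}^{sp}_{2n}|=\Big(\tfrac{1}{18}\,2^{2n}+\tfrac{430}{63}\Big)|\mathcal{M}_{2n}|+o(|\mathcal{M}_{2n}|).$$ -/

import Mathlib

open Filter Asymptotics

namespace MaioranaMcFarland

/-- The coordinate space `𝔽₂ⁿ`. -/
abbrev BVec (n : ℕ) : Type := Fin n → ZMod 2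

/-- The space `𝔽₂²ⁿ`, its vectors being written as pairs `(x, y)` with `x, y ∈ 𝔽₂ⁿ`. -/
abbrev BVec2 (n : ℕ) : Type := BVec n × BVec n

/-- Boolean functions in `2n` variables; `+` on them is the pointwise sum modulo 2. -/
abbrev BoolFun2 (n : ℕ) : Type := BVec2 n → ZMod 2

/-- The characteristic Boolean function of a set `S`. -/
noncomputable def charFun {α : Type} (S : Set α) : α → ZMod 2 := S.indicator 1

/-- `U` is an affine subspace of `𝔽₂²ⁿ` of dimension `n` (the empty set is not one). -/
def IsHalfDim {n : ℕ} (U : AffineSubspace (ZMod 2) (BVec2 n)) : Prop :=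
  (U : Set (BVec2 n)).Nonempty ∧ Module.finrank (ZMod 2) U.direction = n

/-- The restriction of `f` to `U` coincides with that of an affine function on `𝔽₂²ⁿ`. -/
def IsAffineOn {n : ℕ} (f : BoolFun2 n) (U : AffineSubspace (ZMod 2) (BVec2 n)) : Prop :=
  ∃ F : BVec2 n →ᵃ[ZMod 2] ZMod 2, ∀ z ∈ U, f z = F z

/-- The function `(x, y) ↦ ⟨x, π(y)⟩ ⊕ φ(y)`. -/
def mmFun {n : ℕ} (π : Equiv.Perm (BVec n)) (φ : BVec n → ZMod 2) : BoolFun2 n :=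
  fun z => z.1 ⬝ᵥ π z.2 + φ z.2

/-- The Maiorana–McFarland class in `2n` variables. -/
def mmClass (n : ℕ) : Set (BoolFun2 n) :=
  {g | ∃ (π : Equiv.Perm (BVec n)) (φ : BVec n → ZMod 2), g = mmFun π φ}

/-- The functions `f ⊕ 1_U`, where `U` is an `n`-dimensional affine subspace of `𝔽₂²ⁿ` on which
`f` is affine. -/
def nearFun {n : ℕ} (f : BoolFun2 n) : Set (BoolFun2 n) :=
  {g | ∃ U : AffineSubspace (ZMod 2) (BVec2 n),
    IsHalfDim U ∧ IsAffineOn f U ∧ g = f + charFun (U : Set (BVec2 n))}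

/-- The extension of a class `K` by the construction `f ↦ f ⊕ 1_U`. -/
def spClass {n : ℕ} (K : Set (BoolFun2 n)) : Set (BoolFun2 n) :=
  ⋃ f ∈ K, nearFun f

/-- The functions `f ⊕ 1_U`, `f ∈ K`, lying outside the class `K`. -/
def nearClass {n : ℕ} (K : Set (BoolFun2 n)) : Set (BoolFun2 n) :=
  (⋃ f ∈ K, nearFun f) \ K

end MaioranaMcFarland

namespace MaioranaMcFarland

open Matrix Module

/-! Everything rests on a normal form for $f\oplus\mathbf 1_U$ that is unique, so that the count is
exact before any limit is taken. Let $A$ be the projection of $U$ to the $y$-coordinates, $k=\dim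
A$, and let $L$ be the space of directions of $U$ with $y=0$, so $\dim L=n-k$. Affinity of $f$ along
$L$ forces $\langle l,\pi(y)\rangle$ to be independent of $y\in A$ for every $l\in L$; hence $\pi$
maps $A$ onto a coset $B$ of $L^\perp$, again of dimension $k$. In coordinates $t$ on $A$ and $s=$
class of $x$ modulo $L$, $U$ is the graph $s=\gamma(t)$ of an affine map, and up to a linear term in
$x$ the new function over $A$ is $\langle s+\gamma(t),\sigma(t)\rangle+\delta(t)+[s=\gamma(t)]$ with
$\delta$ affine. Off $A$ it is given by a bijection $A^c\to B^c$ and an arbitrary $\varphi$.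
Conversely all such data occur (`exists_glueData`, `GlueData.toFun_mem_spClass`). For $k\le 1$ the
result is again Maiorana–McFarland. For $k\ge 2$ the slices over $A$ are exactly the non-affine
ones, so $A$, then the data off $A$, then $B$, then the local function can be read off
(`glueData_toFun_injective`). Thus $|\mathcal N(\mathcal M_{2n})|$ is the sum over $2\le k\le n$ of
(number of $k$-flats)$^2\cdot(2^n-2^k)!\,2^{2^n-2^k}\cdot$ (number of local functions). With
$q=2^n$, relative to $|\mathcal M_{2n}|$: $k=2$ has only $2^9$ local functions, because $\sigma$ can
be absorbed, and gives $\frac1{18}(q^2+2)+o(1)$; $k=3$ has $8!\,2^{16}$ and gives $\frac{40}7+o(1)$;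
the terms $k\ge4$ sum to $o(1)$. Finally $\frac19+\frac{40}7=\frac{367}{63}$, and $\mathcal
M_{2n}\subseteq\mathcal M^{sp}_{2n}$ adds $1$. -/

/-- The affine subspaces of dimension `k` of `𝔽₂ⁿ`. -/
abbrev Flat (k n : ℕ) : Type :=
  {A : AffineSubspace (ZMod 2) (BVec n) //
    (A : Set (BVec n)).Nonempty ∧ finrank (ZMod 2) A.direction = k}

/-- Affine coordinate systems: an origin and `k` linearly independent directions. -/
abbrev Frame (k n : ℕ) : Type :=
  BVec n × {v : Fin k → BVec n // LinearIndependent (ZMod 2) v}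

instance finite_flat (k n : ℕ) : Finite (Flat k n) :=
  Finite.of_injective (fun A : Flat k n => (A.1 : Set (BVec n)))
    fun _ _ h => Subtype.ext (SetLike.coe_injective h)

/-! ### Flats in coordinates, and their number -/

namespace Frame

variable {k n : ℕ}

/-- The matrix whose rows are the directions of the frame. -/
def mat (F : Frame k n) : Matrix (Fin k) (Fin n) (ZMod 2) := Matrix.of F.2.1

/-- The point with given coordinates. -/
def pt (F : Frame k n) (t : BVec k) : BVec n := F.1 + t ᵥ* F.mat

/-- The transpose of the linear part of `pt`. -/
def dual (F : Frame k n) (x : BVec n) : BVec k := F.mat *ᵥ x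

lemma vecMul_mat_injective (F : Frame k n) : Function.Injective fun t => t ᵥ* F.mat :=
  Matrix.vecMul_injective_iff.2 F.2.2

lemma pt_injective (F : Frame k n) : Function.Injective F.pt := fun _ _ h =>
  F.vecMul_mat_injective (add_left_cancel h)

lemma dotProduct_pt (F : Frame k n) (x : BVec n) (t : BVec k) :
    x ⬝ᵥ F.pt t = x ⬝ᵥ F.1 + F.dual x ⬝ᵥ t := by
  rw [pt, dotProduct_add, dual, dotProduct_comm (F.mat *ᵥ x), dotProduct_mulVec,
    dotProduct_comm x]
  rw [dotProduct_comm x]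

lemma dual_surjective (F : Frame k n) : Function.Surjective F.dual := by
  have h : LinearMap.range F.mat.mulVecLin = ⊤ := by
    apply Submodule.eq_top_of_finrank_eq
    have := F.2.2.rank_matrix (M := F.mat)
    rw [Matrix.rank] at this
    rw [this]; simp
  intro s
  obtain ⟨x, hx⟩ := LinearMap.range_eq_top.1 h s
  exact ⟨x, hx⟩

lemma dual_add (F : Frame k n) (x y : BVec n) : F.dual (x + y) = F.dual x + F.dual y :=
  Matrix.mulVec_add _ _ _

lemma mem_span_iff (F : Frame k n) (y : BVec n) :
    y ∈ Submodule.span (ZMod 2) (Set.range F.2.1) ↔ ∃ t : BVec k, t ᵥ* F.mat = y := by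
  rw [Submodule.mem_span_range_iff_exists_fun]
  refine exists_congr fun t => ?_
  rw [Matrix.vecMul_eq_sum]
  rfl

/-- The affine subspace parametrised by a frame. -/
def flat (F : Frame k n) : Flat k n :=
  ⟨AffineSubspace.mk' F.1 (Submodule.span (ZMod 2) (Set.range F.2.1)),
    AffineSubspace.mk'_nonempty _ _, by
      rw [AffineSubspace.direction_mk', finrank_span_eq_card F.2.2, Fintype.card_fin]⟩

lemma mem_flat (F : Frame k n) (y : BVec n) : y ∈ F.flat.1 ↔ ∃ t, F.pt t = y := by
  rw [flat, AffineSubspace.mem_mk', mem_span_iff]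
  refine exists_congr fun t => ?_
  rw [vsub_eq_sub, eq_sub_iff_add_eq', pt]

end Frame

namespace Flat

variable {k n : ℕ}

lemma exists_frame (A : Flat k n) : ∃ F : Frame k n, F.flat = A := by
  obtain ⟨A, ⟨a, ha⟩, hk⟩ := A
  let b := finBasisOfFinrankEq (ZMod 2) A.direction hk
  refine ⟨(a, ⟨fun i => (b i : BVec n), b.linearIndependent.map' A.direction.subtype
    (Submodule.ker_subtype _)⟩), Subtype.ext ?_⟩
  have : Submodule.span (ZMod 2) (Set.range fun i => (b i : BVec n)) = A.direction := by
    have := congrArg (Submodule.map A.direction.subtype) b.span_eq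
    rw [Submodule.map_span, ← Set.range_comp, Submodule.map_top, Submodule.range_subtype] at this
    exact this
  simp only [Frame.flat, this]
  exact AffineSubspace.mk'_eq ha

/-- A chosen frame of an affine subspace. -/
noncomputable def frame (A : Flat k n) : Frame k n := A.exists_frame.choose

lemma flat_frame (A : Flat k n) : A.frame.flat = A := A.exists_frame.choose_spec

lemma mem_iff (A : Flat k n) (y : BVec n) : y ∈ A.1 ↔ ∃ t, A.frame.pt t = y := by
  rw [← A.frame.mem_flat, A.flat_frame]

lemma pt_mem (A : Flat k n) (t : BVec k) : A.frame.pt t ∈ A.1 := (A.mem_iff _).2 ⟨t, rfl⟩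

lemma mem_direction_iff (A : Flat k n) (y : BVec n) :
    y ∈ A.1.direction ↔ ∃ t : BVec k, t ᵥ* A.frame.mat = y := by
  rw [← A.frame.mem_span_iff]
  conv_lhs => rw [← A.flat_frame]
  rw [Frame.flat, AffineSubspace.direction_mk']

/-- The points of an affine subspace correspond to their coordinates. -/
noncomputable def coordEquiv (A : Flat k n) : BVec k ≃ {y // y ∈ A.1} :=
  Equiv.ofBijective (fun t => ⟨A.frame.pt t, A.pt_mem t⟩)
    ⟨fun _ _ h => A.frame.pt_injective (congrArg Subtype.val h), fun y => by
      obtain ⟨t, ht⟩ := (A.mem_iff _).1 y.2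
      exact ⟨t, Subtype.ext ht⟩⟩

lemma card_points (A : Flat k n) : Nat.card {y // y ∈ A.1} = 2 ^ k := by
  rw [← Nat.card_congr A.coordEquiv]; simp

lemma dimension_le (A : Flat k n) : k ≤ n := by
  have := Submodule.finrank_le A.1.direction
  rw [A.2.2] at this
  simpa using this

end Flat

lemma card_frame {k n : ℕ} (h : k ≤ n) :
    Nat.card (Frame k n) = 2 ^ n * ∏ i : Fin k, (2 ^ n - 2 ^ (i : ℕ)) := by
  rw [Nat.card_prod, card_linearIndependent (by simpa using h)]
  simp

/-- A frame is an affine subspace together with a frame of the coordinate space. -/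
theorem card_flat_mul_card_frame (k n : ℕ) :
    Nat.card (Flat k n) * Nat.card (Frame k k) = Nat.card (Frame k n) := by
  rw [← Nat.card_prod]
  have hli (A : Flat k n) (v : Fin k → BVec k) (hv : LinearIndependent (ZMod 2) v) :
      LinearIndependent (ZMod 2) (fun i => v i ᵥ* A.frame.mat) := by
    have hinj : LinearMap.ker (Matrix.vecMulLinear A.frame.mat) = ⊥ :=
      LinearMap.ker_eq_bot.2 A.frame.vecMul_mat_injective
    have := hv.map' (Matrix.vecMulLinear A.frame.mat) hinj
    exact this
  let Φ : Flat k n × Frame k k → Frame k n := fun p =>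
    (p.1.frame.pt p.2.1, ⟨_, hli p.1 p.2.2.1 p.2.2.2⟩)
  -- A composed frame still spans the flat it came from, so the flat is recovered from the image.
  have hflat (p : Flat k n × Frame k k) : (Φ p).flat = p.1 := by
    apply Subtype.ext
    have hle : Submodule.span (ZMod 2) (Set.range (Φ p).2.1) ≤ p.1.1.direction := by
      rw [Submodule.span_le]
      rintro _ ⟨i, rfl⟩
      exact (p.1.mem_direction_iff _).2 ⟨_, rfl⟩
    have heq := Submodule.eq_of_le_of_finrank_eq hle (by
      rw [p.1.2.2, finrank_span_eq_card (Φ p).2.2, Fintype.card_fin])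
    simp only [Frame.flat, heq]
    exact AffineSubspace.mk'_eq (p.1.pt_mem _)
  refine Nat.card_congr (Equiv.ofBijective Φ ⟨?_, ?_⟩)
  · rintro ⟨A, a, v⟩ ⟨A', a', v'⟩ h
    obtain rfl : A = A' := (hflat (A, a, v)).symm.trans ((congrArg _ h).trans (hflat _))
    have h1 : a = a' := A.frame.pt_injective (congrArg Prod.fst h)
    have h2 : v = v' := Subtype.ext <| funext fun i =>
      A.frame.vecMul_mat_injective (congrFun (congrArg (fun q => q.2.1) h) i)
    rw [h1, h2]
  · intro F
    have hdir : F.flat.1.direction = Submodule.span (ZMod 2) (Set.range F.2.1) :=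
      AffineSubspace.direction_mk' _ _
    obtain ⟨a, ha⟩ := (F.flat.mem_iff F.1).1 (AffineSubspace.self_mem_mk' _ _)
    have hv (i : Fin k) : ∃ t : BVec k, t ᵥ* F.flat.frame.mat = F.2.1 i := by
      rw [← F.flat.mem_direction_iff, hdir]
      exact Submodule.subset_span ⟨i, rfl⟩
    choose v hv using hv
    have hli' : LinearIndependent (ZMod 2) v := by
      apply LinearIndependent.of_comp (Matrix.vecMulLinear F.flat.frame.mat)
      convert F.2.2
      exact funext hv
    exact ⟨(F.flat, a, ⟨v, hli'⟩), Prod.ext ha (Subtype.ext (funext hv))⟩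

/-- A chosen frame embeds flats into $(k+1)$-tuples of vectors; this crude bound suffices for the
tail. -/
lemma card_flat_le (k n : ℕ) : Nat.card (Flat k n) ≤ (2 ^ n) ^ (k + 1) := by
  have h : Function.Injective fun A : Flat k n => (A.frame.1, A.frame.2.1) := fun A B h => by
    rw [← A.flat_frame, ← B.flat_frame]
    have h1 := congrArg Prod.fst h
    have h2 := congrArg Prod.snd h
    have : A.frame = B.frame := Prod.ext h1 (Subtype.ext h2)
    rw [this]
  refine (Nat.card_le_card_of_injective _ h).trans ?_
  rw [Nat.card_prod, pow_succ']
  simp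

/-! ### Local data and glued functions -/

/-- A permutation `σ` of `𝔽₂ᵏ`, an affine map `γ` from `𝔽₂ᵏ` to itself and an affine form `δ`
on `𝔽₂ᵏ`. -/
abbrev LocalData (k : ℕ) : Type :=
  Equiv.Perm (BVec k) × (Matrix (Fin k) (Fin k) (ZMod 2) × BVec k) × (BVec k × ZMod 2)

namespace LocalData

variable {k : ℕ}

/-- The affine map of local data. -/
def aff (p : LocalData k) (t : BVec k) : BVec k := t ᵥ* p.2.1.1 + p.2.1.2

/-- The affine form of local data. -/
def form (p : LocalData k) (t : BVec k) : ZMod 2 := t ⬝ᵥ p.2.2.1 + p.2.2.2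

/-- The function `(s, t) ↦ ⟨s ⊕ γ(t), σ(t)⟩ ⊕ δ(t) ⊕ [s = γ(t)]`. -/
noncomputable def toFun (p : LocalData k) (s t : BVec k) : ZMod 2 :=
  (s + p.aff t) ⬝ᵥ p.1 t + p.form t + charFun {p.aff t} s

end LocalData

/-- The functions defined by local data. -/
def localSet (k : ℕ) : Set (BVec k → BVec k → ZMod 2) := Set.range LocalData.toFun

lemma charFun_of_mem {α : Type} {S : Set α} {a : α} (h : a ∈ S) : charFun S a = 1 := by
  simp [charFun, h]

lemma charFun_of_notMem {α : Type} {S : Set α} {a : α} (h : a ∉ S) : charFun S a = 0 := by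
  simp [charFun, h]

lemma dotProduct_left_injective {n : ℕ} {p q : BVec n} {c d : ZMod 2}
    (h : ∀ x : BVec n, x ⬝ᵥ p + c = x ⬝ᵥ q + d) : p = q ∧ c = d := by
  have h0 : c = d := by simpa using h 0
  subst h0
  exact ⟨funext fun i => by simpa using h (Pi.single i 1), rfl⟩

section Glue

variable {k n : ℕ}

open Classical in
/-- The function that on the fibres over `A` is given by `h` in the chosen coordinates of `A` and
`B`, and elsewhere is of Maiorana–McFarland form. -/
noncomputable def glue (A B : Flat k n) (e : {y // y ∉ A.1} ≃ {y // y ∉ B.1})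
    (φ : {y // y ∉ A.1} → ZMod 2) (h : BVec k → BVec k → ZMod 2) : BoolFun2 n := fun z =>
  if hy : z.2 ∈ A.1 then
    z.1 ⬝ᵥ B.frame.1 + h (B.frame.dual z.1) (A.coordEquiv.symm ⟨z.2, hy⟩)
  else z.1 ⬝ᵥ (e ⟨z.2, hy⟩).1 + φ ⟨z.2, hy⟩

variable (A B : Flat k n) (e : {y // y ∉ A.1} ≃ {y // y ∉ B.1})
    (φ : {y // y ∉ A.1} → ZMod 2) (h : BVec k → BVec k → ZMod 2)

lemma glue_pt (x : BVec n) (t : BVec k) :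
    glue A B e φ h (x, A.frame.pt t) = x ⬝ᵥ B.frame.1 + h (B.frame.dual x) t := by
  have : A.coordEquiv.symm ⟨A.frame.pt t, A.pt_mem t⟩ = t := A.coordEquiv.symm_apply_apply t
  simp only [glue, A.pt_mem t, dif_pos, this]

lemma glue_of_notMem (x : BVec n) (y : {y // y ∉ A.1}) :
    glue A B e φ h (x, y) = x ⬝ᵥ (e y).1 + φ y := by
  simp [glue, y.2]

lemma eq_glue_iff (g : BoolFun2 n) : g = glue A B e φ h ↔
    (∀ x t, g (x, A.frame.pt t) = x ⬝ᵥ B.frame.1 + h (B.frame.dual x) t) ∧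
      ∀ x (y : {y // y ∉ A.1}), g (x, y) = x ⬝ᵥ (e y).1 + φ y := by
  constructor
  · rintro rfl
    exact ⟨glue_pt A B e φ h, glue_of_notMem A B e φ h⟩
  · rintro ⟨h1, h2⟩
    ext ⟨x, y⟩
    by_cases hy : y ∈ A.1
    · obtain ⟨t, rfl⟩ := (A.mem_iff y).1 hy
      rw [h1, glue_pt]
    · rw [h2 x ⟨y, hy⟩, glue_of_notMem A B e φ h x ⟨y, hy⟩]

/-- Summed over a plane through the point $\gamma(t)$, an affine function gives $0$, whereas the
indicator of $\gamma(t)$ contributes $1$. A plane exists since $k\ge2$. -/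
lemma localFun_slice_not_affine (hk : 2 ≤ k) (p : LocalData k) (B : Flat k n) (t : BVec k)
    (q : BVec n) (c : ZMod 2) :
    ¬ ∀ x : BVec n, x ⬝ᵥ B.frame.1 + p.toFun (B.frame.dual x) t = x ⬝ᵥ q + c := by
  intro H
  let i : Fin k := ⟨0, by omega⟩
  let j : Fin k := ⟨1, by omega⟩
  have hij : i ≠ j := by simp [i, j]
  obtain ⟨x, hx⟩ := B.frame.dual_surjective (p.aff t)
  obtain ⟨u, hu⟩ := B.frame.dual_surjective (Pi.single i 1)
  obtain ⟨v, hv⟩ := B.frame.dual_surjective (Pi.single j 1)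
  have e0 := H x
  have e1 := H (x + u)
  have e2 := H (x + v)
  have e3 := H (x + u + v)
  have hu0 : (Pi.single i 1 : BVec k) ≠ 0 := by simp
  have hv0 : (Pi.single j 1 : BVec k) ≠ 0 := by simp
  have huv0 : (Pi.single i 1 + Pi.single j 1 : BVec k) ≠ 0 := fun h => by
    have := congrFun h i
    simp [hij] at this
  simp only [LocalData.toFun, Frame.dual_add, hx, hu, hv] at e0 e1 e2 e3
  rw [charFun_of_mem (by simp)] at e0
  rw [charFun_of_notMem (by simp)] at e1 e2
  rw [charFun_of_notMem (by rw [add_assoc, Set.mem_singleton_iff, add_eq_left]; exact huv0)] at e3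
  simp only [add_dotProduct] at e0 e1 e2 e3
  have h2 : (2 : ZMod 2) = 0 := rfl
  have : (1 : ZMod 2) = 0 := by
    linear_combination e0 + e1 + e2 + e3 + h2 * (2 * x ⬝ᵥ q + u ⬝ᵥ q + v ⬝ᵥ q + 2 * c
      - 2 * x ⬝ᵥ B.frame.1 - u ⬝ᵥ B.frame.1 - v ⬝ᵥ B.frame.1 - 4 * p.aff t ⬝ᵥ p.1 t
      - 2 * p.form t - Pi.single i 1 ⬝ᵥ p.1 t - Pi.single j 1 ⬝ᵥ p.1 t)
  exact one_ne_zero this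

end Glue

/-- The data of a glued function. -/
abbrev GlueData (k n : ℕ) : Type :=
  Σ A : Flat k n, Σ B : Flat k n,
    ({y // y ∉ A.1} ≃ {y // y ∉ B.1}) × ({y // y ∉ A.1} → ZMod 2) × localSet k

/-- The function defined by gluing data. -/
noncomputable def GlueData.toFun {k n : ℕ} (D : GlueData k n) : BoolFun2 n :=
  glue D.1 D.2.1 D.2.2.1 D.2.2.2.1 D.2.2.2.2

lemma GlueData.mem_iff_not_affine {k n : ℕ} (hk : 2 ≤ k) (D : GlueData k n) (y : BVec n) :
    y ∈ D.1.1 ↔ ¬ ∃ q c, ∀ x, D.toFun (x, y) = x ⬝ᵥ q + c := by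
  obtain ⟨A, B, e, φ, _, p, rfl⟩ := D
  constructor
  · intro hy
    obtain ⟨t, rfl⟩ := (A.mem_iff y).1 hy
    rintro ⟨q, c, H⟩
    refine localFun_slice_not_affine hk p B t q c fun x => ?_
    rw [← H, GlueData.toFun, glue_pt]
  · intro H
    by_contra hy
    exact H ⟨_, _, fun x => glue_of_notMem A B e φ _ x ⟨y, hy⟩⟩

theorem glueData_toFun_injective (n : ℕ) (I : Finset ℕ) (hI : ∀ k ∈ I, 2 ≤ k) :
    Function.Injective fun D : (Σ k : I, GlueData k n) => D.2.toFun := by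
  rintro ⟨⟨k, hk⟩, D⟩ ⟨⟨k', hk'⟩, D'⟩ heq
  change D.toFun = D'.toFun at heq
  have hset : D.1.1 = D'.1.1 := AffineSubspace.ext fun y => by
    rw [D.mem_iff_not_affine (hI k hk), D'.mem_iff_not_affine (hI k' hk'), heq]
  obtain rfl : k = k' := 
    D.1.2.2.symm.trans ((congrArg (fun C : AffineSubspace (ZMod 2) (BVec n) =>
      finrank (ZMod 2) C.direction) hset).trans D'.1.2.2)
  obtain ⟨A, B, e, φ, h⟩ := D
  obtain ⟨A', B', e', φ', h'⟩ := D'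
  obtain rfl : A = A' := Subtype.ext hset
  have hoff (y : {y // y ∉ A.1}) : (e y).1 = (e' y).1 ∧ φ y = φ' y :=
    dotProduct_left_injective fun x => by
      have := congrFun heq (x, y.1)
      rwa [GlueData.toFun, GlueData.toFun, glue_of_notMem, glue_of_notMem] at this
  -- $B$ is the complement of the image of the bijection off $A$, which is already known.
  have hB : B.1 = B'.1 := by
    have key {C D : Flat k n} {c : {y // y ∉ A.1} ≃ {y // y ∉ C.1}}
        {d : {y // y ∉ A.1} ≃ {y // y ∉ D.1}} (hcd : ∀ y, (c y).1 = (d y).1) (z : BVec n)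
        (hz : z ∈ D.1) : z ∈ C.1 := by
      by_contra hzC
      have := (d (c.symm ⟨z, hzC⟩)).2
      rw [← hcd, Equiv.apply_symm_apply] at this
      exact this hz
    exact AffineSubspace.ext fun z =>
      ⟨key (fun y => (hoff y).1.symm) z, key (fun y => (hoff y).1) z⟩
  obtain rfl : B = B' := Subtype.ext hB
  obtain rfl : e = e' := Equiv.ext fun y => Subtype.ext (hoff y).1
  obtain rfl : φ = φ' := funext fun y => (hoff y).2
  obtain rfl : h = h' := by
    refine Subtype.ext (funext fun s => funext fun t => ?_)
    obtain ⟨x, rfl⟩ := B.frame.dual_surjective s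
    have := congrFun heq (x, A.frame.pt t)
    rw [GlueData.toFun, GlueData.toFun, glue_pt, glue_pt] at this
    exact add_left_cancel this
  rfl

/-! ### Glued functions arise from the class -/

section

variable {k n : ℕ}

/-- By `Frame.dotProduct_pt`, the local term $\langle s,\sigma(t)\rangle$ plus the pairing with the
origin of $B$ is $\langle x,\cdot\rangle$ with the point of $B$ of coordinates $\sigma(t)$; so
$\sigma$ and `e` patch to a permutation. -/
lemma glue_mem_mmClass (A B : Flat k n) (e : {y // y ∉ A.1} ≃ {y // y ∉ B.1})
    (φ : {y // y ∉ A.1} → ZMod 2) (σ : Equiv.Perm (BVec k)) (ψ : BVec k → ZMod 2) :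
    glue A B e φ (fun s t => s ⬝ᵥ σ t + ψ t) ∈ mmClass n := by
  classical
  let π : Equiv.Perm (BVec n) :=
    Equiv.subtypeCongr ((A.coordEquiv.symm.trans σ).trans B.coordEquiv) e
  let Φ : BVec n → ZMod 2 := fun y =>
    if hy : y ∈ A.1 then ψ (A.coordEquiv.symm ⟨y, hy⟩) else φ ⟨y, hy⟩
  refine ⟨π, Φ, Eq.symm ((eq_glue_iff A B e φ _ _).2 ⟨fun x t => ?_, fun x y => ?_⟩)⟩
  · have h1 : A.coordEquiv.symm ⟨A.frame.pt t, A.pt_mem t⟩ = t :=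
      A.coordEquiv.symm_apply_apply t
    have h2 : π (A.frame.pt t) = B.frame.pt (σ t) := by
      simp only [π, Equiv.subtypeCongr, Equiv.trans_apply,
        Equiv.sumCompl_symm_apply_of_pos (A.pt_mem t)]
      simp only [Equiv.sumCongr_apply, Sum.map_inl, Equiv.trans_apply, h1]
      rfl
    simp only [mmFun, h2, Φ, A.pt_mem t, dif_pos, h1, Frame.dotProduct_pt, add_assoc]
  · have h2 : π y = e y := by
      simp only [π, Equiv.subtypeCongr, Equiv.trans_apply,
        Equiv.sumCompl_symm_apply_of_neg y.2]
      rfl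
    simp only [mmFun, h2, Φ, y.2, dif_neg, not_false_eq_true, Subtype.coe_eta]

/-- The graph-like subspace attached to two flats of dimension `k` and an affine map. -/
lemma exists_isHalfDim (A B : Flat k n) (M : Matrix (Fin k) (Fin k) (ZMod 2)) (c : BVec k) :
    ∃ U : AffineSubspace (ZMod 2) (BVec2 n), IsHalfDim U ∧
      ∀ x y, (x, y) ∈ U ↔ ∃ t, A.frame.pt t = y ∧ B.frame.dual x = t ᵥ* M + c := by
  obtain ⟨x₀, hx₀⟩ := B.frame.dual_surjective c
  -- The direction of $U$ is the embedded kernel of this surjection onto $\mathbb F_2^k$, of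
  -- dimension $(n+k)-k=n$.
  let D : BVec n × BVec k →ₗ[ZMod 2] BVec k :=
    (Matrix.mulVecLin B.frame.mat).comp (LinearMap.fst _ _ _) -
      (Matrix.vecMulLinear M).comp (LinearMap.snd _ _ _)
  have hD (x : BVec n) (t : BVec k) : D (x, t) = B.frame.dual x - t ᵥ* M := rfl
  let E : BVec n × BVec k →ₗ[ZMod 2] BVec2 n :=
    LinearMap.prodMap LinearMap.id (Matrix.vecMulLinear A.frame.mat)
  have hE (x : BVec n) (t : BVec k) : E (x, t) = (x, t ᵥ* A.frame.mat) := rfl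
  have hEinj : Function.Injective E := by
    rintro ⟨x, t⟩ ⟨x', t'⟩ h
    rw [hE, hE] at h
    rw [Prod.ext_iff] at h
    rw [show x = x' from h.1, A.frame.vecMul_mat_injective h.2]
  have hDsurj : LinearMap.range D = ⊤ := LinearMap.range_eq_top.2 fun s => by
    obtain ⟨x, hx⟩ := B.frame.dual_surjective s
    exact ⟨(x, 0), by rw [hD, hx, Matrix.zero_vecMul, sub_zero]⟩
  refine ⟨AffineSubspace.mk' (x₀, A.frame.1) ((LinearMap.ker D).map E),
    ⟨AffineSubspace.mk'_nonempty _ _, ?_⟩, fun x y => ?_⟩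
  · rw [AffineSubspace.direction_mk',
      ← (Submodule.equivMapOfInjective E hEinj (LinearMap.ker D)).finrank_eq]
    have := D.finrank_range_add_finrank_ker
    rw [hDsurj] at this
    simp at this
    omega
  · rw [AffineSubspace.mem_mk', Submodule.mem_map]
    have hadd : B.frame.dual (x - x₀) = B.frame.dual x - c := by
      rw [← hx₀]; exact Matrix.mulVec_sub _ _ _
    constructor
    · rintro ⟨⟨x', t⟩, hker, h⟩
      rw [hE, Prod.ext_iff] at h
      obtain ⟨h1, h2⟩ := h
      change x' = x - x₀ at h1
      change t ᵥ* A.frame.mat = y - A.frame.1 at h2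
      rw [LinearMap.mem_ker, hD, h1, hadd, sub_eq_zero, sub_eq_iff_eq_add] at hker
      exact ⟨t, by rw [Frame.pt, h2]; abel, hker⟩
    · rintro ⟨t, rfl, h⟩
      refine ⟨(x - x₀, t), ?_, ?_⟩
      · rw [LinearMap.mem_ker, hD, hadd, h]; abel
      · rw [hE, Frame.pt]
        ext1
        · rfl
        · change _ = A.frame.1 + t ᵥ* A.frame.mat - A.frame.1
          abel

lemma exists_affineMap_pt (A : Flat k n) (b : BVec n) (d : BVec k) (d₀ : ZMod 2) :
    ∃ F : BVec2 n →ᵃ[ZMod 2] ZMod 2, ∀ x t, F (x, A.frame.pt t) = x ⬝ᵥ b + (t ⬝ᵥ d + d₀) := by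
  obtain ⟨r, hr⟩ := LinearMap.exists_leftInverse_of_injective (Matrix.vecMulLinear A.frame.mat)
    (LinearMap.ker_eq_bot.2 A.frame.vecMul_mat_injective)
  have hr' (t : BVec k) : r (t ᵥ* A.frame.mat) = t := LinearMap.congr_fun hr t
  let Λ : BVec2 n →ₗ[ZMod 2] ZMod 2 :=
    (dotProductEquiv (ZMod 2) (Fin n) b).comp (LinearMap.fst _ _ _) +
      ((dotProductEquiv (ZMod 2) (Fin k) d).comp r).comp (LinearMap.snd _ _ _)
  have hΛ (x y : BVec n) : Λ (x, y) = b ⬝ᵥ x + d ⬝ᵥ r y := rfl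
  refine ⟨Λ.toAffineMap + AffineMap.const _ _ (d₀ - d ⬝ᵥ r A.frame.1), fun x t => ?_⟩
  change Λ (x, A.frame.pt t) + (d₀ - d ⬝ᵥ r A.frame.1) = _
  rw [hΛ, Frame.pt, map_add, hr', dotProduct_add, dotProduct_comm b, dotProduct_comm d t]
  ring

/-- Glued functions arise from the Maiorana–McFarland class by changing a function on a subspace
of half the dimension. -/
theorem GlueData.toFun_mem_spClass (D : GlueData k n) : D.toFun ∈ spClass (mmClass n) := by
  obtain ⟨A, B, e, φ, _, p, rfl⟩ := D
  -- The function to be modified: on $s=\gamma(t)$ the two terms $\langle\gamma(t),\sigma(t)\rangle$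
  -- cancel and the affine form $\delta$ remains.
  have hf := glue_mem_mmClass A B e φ p.1 fun t => p.aff t ⬝ᵥ p.1 t + p.form t
  obtain ⟨U, hU, hmem⟩ := exists_isHalfDim A B p.2.1.1 p.2.1.2
  have hmem_pt (x : BVec n) (t : BVec k) :
      (x, A.frame.pt t) ∈ U ↔ B.frame.dual x = p.aff t := by
    rw [hmem]
    constructor
    · rintro ⟨t', h1, h2⟩
      rw [A.frame.pt_injective h1] at h2
      exact h2
    · exact fun h => ⟨t, rfl, h⟩
  obtain ⟨F, hF⟩ := exists_affineMap_pt A B.frame.1 p.2.2.1 p.2.2.2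
  have h2 : (2 : ZMod 2) = 0 := rfl
  refine Set.mem_iUnion₂.2 ⟨_, hf, U, hU, ⟨F, ?_⟩, Eq.symm ?_⟩
  · rintro ⟨x, y⟩ hz
    obtain ⟨t, rfl, -⟩ := (hmem x y).1 hz
    have := (hmem_pt x t).1 hz
    rw [glue_pt, hF, this]
    simp only [LocalData.form]
    linear_combination h2 * p.aff t ⬝ᵥ p.1 t
  · refine (eq_glue_iff _ _ _ _ _ _).2 ⟨fun x t => ?_, fun x y => ?_⟩
    · rw [Pi.add_apply, glue_pt]
      have : charFun (U : Set (BVec2 n)) (x, A.frame.pt t) =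
          charFun {p.aff t} (B.frame.dual x) := by
        by_cases h : B.frame.dual x = p.aff t
        · rw [charFun_of_mem ((hmem_pt x t).2 h), charFun_of_mem (by simp [h])]
        · rw [charFun_of_notMem fun h' => h ((hmem_pt x t).1 h'), charFun_of_notMem (by simp [h])]
      simp only [this, LocalData.toFun, add_dotProduct]
      ring
    · rw [Pi.add_apply, glue_of_notMem, charFun_of_notMem, add_zero]
      intro h
      obtain ⟨t, ht, -⟩ := (hmem x y).1 h
      exact y.2 (ht ▸ A.pt_mem t)

lemma mmClass_slice_affine {g : BoolFun2 n} (hg : g ∈ mmClass n) (y : BVec n) :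
    ∃ q c, ∀ x, g (x, y) = x ⬝ᵥ q + c := by
  obtain ⟨π, φ, rfl⟩ := hg
  exact ⟨π y, φ y, fun x => rfl⟩

theorem GlueData.toFun_mem_nearClass (hk : 2 ≤ k) (D : GlueData k n) :
    D.toFun ∈ nearClass (mmClass n) := by
  refine ⟨D.toFun_mem_spClass, fun h => ?_⟩
  obtain ⟨y, hy⟩ := D.1.2.1
  exact (D.mem_iff_not_affine hk y).1 hy (mmClass_slice_affine h y)

/-- In dimension at most one gluing stays in the Maiorana–McFarland class. -/
theorem GlueData.toFun_mem_mmClass (hk : k < 2) (D : GlueData k n) : D.toFun ∈ mmClass n := by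
  obtain ⟨A, B, e, φ, _, p, rfl⟩ := D
  change glue A B e φ p.toFun ∈ _
  obtain rfl | rfl : k = 0 ∨ k = 1 := by omega
  · convert glue_mem_mmClass A B e φ p.1 (fun t => p.form t + 1) using 2
    ext s t
    rw [LocalData.toFun, charFun_of_mem (Set.mem_singleton_iff.2 (Subsingleton.elim s _))]
    simp
  -- For $k=1$ the indicator is $s+\gamma(t)+1$, which amounts to replacing $\sigma$ by $\sigma+1$.
  · convert glue_mem_mmClass A B e φ (p.1.trans (Equiv.addRight 1))
      (fun t => p.aff t ⬝ᵥ (p.1 t + 1) + p.form t + 1) using 2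
    ext s t
    rw [LocalData.toFun]
    have key : ∀ a b c : ZMod 2, (a + b) * c + (if a = b then 1 else 0) =
        a * (c + 1) + b * (c + 1) + 1 := by decide
    have hc : charFun {p.aff t} s = if s 0 = p.aff t 0 then 1 else 0 := by
      split_ifs with h
      · exact charFun_of_mem (funext fun i => by rw [Subsingleton.elim i 0]; exact h)
      · exact charFun_of_notMem fun h' => h (congrFun h' 0)
    rw [hc]
    have := key (s 0) (p.aff t 0) (p.1 t 0)
    simp only [dotProduct, Fin.sum_univ_one, Pi.add_apply, Equiv.trans_apply,
      Equiv.coe_addRight, Pi.one_apply]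
    linear_combination this

end

/-! ### Every modified function is glued -/

lemma exists_eq_dotProduct {n : ℕ} (f : BVec n →ₗ[ZMod 2] ZMod 2) : ∃ d, ∀ x, f x = x ⬝ᵥ d := by
  refine ⟨(dotProductEquiv (ZMod 2) (Fin n)).symm f, fun x => ?_⟩
  conv_lhs => rw [← (dotProductEquiv (ZMod 2) (Fin n)).apply_symm_apply f]
  exact dotProduct_comm ((dotProductEquiv (ZMod 2) (Fin n)).symm f) x

/-- The orthogonal complement for the standard bilinear form. -/
lemma exists_orthogonal {n : ℕ} (L : Submodule (ZMod 2) (BVec n)) :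
    ∃ W : Submodule (ZMod 2) (BVec n), finrank (ZMod 2) W = n - finrank (ZMod 2) L ∧
      (∀ w, w ∈ W ↔ ∀ l ∈ L, l ⬝ᵥ w = 0) ∧ ∀ l, l ∈ L ↔ ∀ w ∈ W, l ⬝ᵥ w = 0 := by
  let β : LinearMap.BilinForm (ZMod 2) (BVec n) := Matrix.toBilin' 1
  have hβ (x y : BVec n) : β x y = x ⬝ᵥ y := by
    simp only [β, Matrix.toBilin'_apply', Matrix.one_mulVec]
  have hnd : β.Nondegenerate :=
    Matrix.nondegenerate_toBilin'_iff.2 (Matrix.nondegenerate_of_det_ne_zero (by simp))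
  have hrefl : β.IsRefl := fun x y h => by rw [hβ] at h ⊢; rwa [dotProduct_comm]
  refine ⟨β.orthogonal L, ?_, fun w => ?_, fun l => ?_⟩
  · rw [LinearMap.BilinForm.finrank_orthogonal hnd]; simp
  · simp only [LinearMap.BilinForm.mem_orthogonal_iff, hβ]
  · conv_lhs => rw [← LinearMap.BilinForm.orthogonal_orthogonal hnd hrefl L]
    rw [LinearMap.BilinForm.mem_orthogonal_iff]
    simp only [hβ, dotProduct_comm l]

lemma finrank_comap_inl_add_finrank_map_snd {n : ℕ} (V : Submodule (ZMod 2) (BVec2 n)) :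
    finrank (ZMod 2) (V.comap (LinearMap.inl (ZMod 2) (BVec n) (BVec n))) +
      finrank (ZMod 2) (V.map (LinearMap.snd (ZMod 2) (BVec n) (BVec n))) =
      finrank (ZMod 2) V := by
  set L := V.comap (LinearMap.inl (ZMod 2) (BVec n) (BVec n)) with hL
  have h := (LinearMap.domRestrict (LinearMap.snd (ZMod 2) (BVec n) (BVec n))
    V).finrank_range_add_finrank_ker
  rw [LinearMap.range_domRestrict] at h
  have hker : finrank (ZMod 2)
      (LinearMap.ker (LinearMap.domRestrict (LinearMap.snd (ZMod 2) (BVec n) (BVec n)) V)) =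
      finrank (ZMod 2) L := by
    rw [(Submodule.equivSubtypeMap V _).finrank_eq,
      (Submodule.equivMapOfInjective _ (LinearMap.inl_injective
        (R := ZMod 2) (M := BVec n) (M₂ := BVec n)) L).finrank_eq]
    refine congrArg (fun S : Submodule (ZMod 2) (BVec2 n) => finrank (ZMod 2) S) ?_
    ext ⟨x, y⟩
    constructor
    · rintro ⟨⟨z, hz⟩, hz0, hzxy⟩
      obtain rfl : z = (x, y) := hzxy
      obtain rfl : y = 0 := hz0
      exact ⟨x, hz, rfl⟩
    · rintro ⟨x', hx', h⟩
      exact ⟨⟨(x, y), h ▸ hx'⟩, (congrArg Prod.snd h).symm, rfl⟩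
  rw [← h, hker, add_comm]

/-- Changing a Maiorana–McFarland function on a subspace of half the dimension on which it is
affine yields a glued function. -/
theorem exists_glueData {n : ℕ} (π : Equiv.Perm (BVec n)) (φ : BVec n → ZMod 2)
    (U : AffineSubspace (ZMod 2) (BVec2 n)) (hU : IsHalfDim U) (hF : IsAffineOn (mmFun π φ) U) :
    ∃ k, ∃ D : GlueData k n, D.toFun = mmFun π φ + charFun (U : Set (BVec2 n)) := by
  obtain ⟨⟨⟨x₁, y₁⟩, hp⟩, hdim⟩ := hU
  obtain ⟨F, hF⟩ := hF
  have hmemU {z : BVec2 n} (q : BVec2 n) (hq : q ∈ U) : z ∈ U ↔ z - q ∈ U.direction :=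
    (AffineSubspace.vsub_right_mem_direction_iff_mem hq z).symm
  set V := U.direction with hV
  set L := V.comap (LinearMap.inl (ZMod 2) (BVec n) (BVec n)) with hL
  have hmemL (l : BVec n) : l ∈ L ↔ (l, 0) ∈ V := Iff.rfl
  obtain ⟨W, hWdim, hW, hLW⟩ := exists_orthogonal L
  have hrank := finrank_comap_inl_add_finrank_map_snd V
  rw [hdim, ← hL] at hrank
  set k := finrank (ZMod 2) (V.map (LinearMap.snd (ZMod 2) (BVec n) (BVec n))) with hk
  obtain ⟨u, hu⟩ := exists_eq_dotProduct (F.linear.comp (LinearMap.inl (ZMod 2) (BVec n) (BVec n)))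
  replace hu (x : BVec n) : F.linear (x, 0) = x ⬝ᵥ u := hu x
  let A : Flat k n := ⟨AffineSubspace.mk' y₁ (V.map (LinearMap.snd (ZMod 2) (BVec n) (BVec n))),
    AffineSubspace.mk'_nonempty _ _, by rw [AffineSubspace.direction_mk']⟩
  let B : Flat k n := ⟨AffineSubspace.mk' u W, AffineSubspace.mk'_nonempty _ _, by
    rw [AffineSubspace.direction_mk', hWdim]; omega⟩
  have hA (y : BVec n) : y ∈ A.1 ↔ ∃ x, (x, y) ∈ U := by
    rw [show y ∈ A.1 ↔ y - y₁ ∈ V.map (LinearMap.snd (ZMod 2) (BVec n) (BVec n)) from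
      AffineSubspace.mem_mk']
    constructor
    · rintro ⟨⟨x', y'⟩, hv, h⟩
      refine ⟨x₁ + x', (hmemU _ hp).2 ?_⟩
      rw [Prod.mk_sub_mk, add_sub_cancel_left, ← h]
      exact hv
    · rintro ⟨x, h⟩
      exact ⟨_, (hmemU _ hp).1 h, rfl⟩
  have hAdir (v : BVec n) : v ∈ A.1.direction ↔ ∃ x, (x, v) ∈ V := by
    rw [show A.1.direction = _ from AffineSubspace.direction_mk' _ _]
    constructor
    · rintro ⟨⟨x', y'⟩, hv, rfl⟩
      exact ⟨x', hv⟩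
    · rintro ⟨x, h⟩
      exact ⟨_, h, rfl⟩
  have hBdir : B.1.direction = W := AffineSubspace.direction_mk' _ _
  -- Moving by $l\in L$ inside $U$ changes $f$ by $\langle l,\pi(y)\rangle$ and $F$ by $\langle
  -- l,u\rangle$.
  have hmaps (y : BVec n) (hy : y ∈ A.1) : π y ∈ B.1 := by
    rw [show π y ∈ B.1 ↔ π y - u ∈ W from AffineSubspace.mem_mk', hW]
    intro l hl
    obtain ⟨x, hx⟩ := (hA y).1 hy
    have hx' : (l + x, y) ∈ U := by
      rw [hmemU _ hx, Prod.mk_sub_mk, add_sub_cancel_right, sub_self]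
      exact hl
    have h1 := hF _ hx
    have h2 := hF _ hx'
    have h3 := F.map_vadd (x, y) (l, 0)
    rw [hu] at h3
    simp only [vadd_eq_add, Prod.mk_add_mk, zero_add] at h3
    rw [h3, ← h1] at h2
    simp only [mmFun, add_dotProduct] at h2
    rw [dotProduct_sub]
    linear_combination h2
  have hAB (y : BVec n) : y ∈ A.1 ↔ π y ∈ B.1 := by
    have hsub : π '' (A.1 : Set (BVec n)) ⊆ (B.1 : Set (BVec n)) := by
      rintro _ ⟨y, hy, rfl⟩
      exact hmaps y hy
    have heq := Set.eq_of_subset_of_ncard_le hsub (by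
      rw [Set.ncard_image_of_injective _ π.injective]
      exact (B.card_points.trans A.card_points.symm).le)
    refine ⟨hmaps y, fun h => ?_⟩
    obtain ⟨y', hy', h'⟩ := (Set.ext_iff.1 heq (π y)).2 h
    exact π.injective h' ▸ hy'
  let e : {y // y ∉ A.1} ≃ {y // y ∉ B.1} := π.subtypeEquiv fun y => not_congr (hAB y)
  let σ : Equiv.Perm (BVec k) :=
    (A.coordEquiv.trans (π.subtypeEquiv hAB)).trans B.coordEquiv.symm
  have hσ (t : BVec k) : B.frame.pt (σ t) = π (A.frame.pt t) :=
    congrArg Subtype.val (B.coordEquiv.apply_symm_apply _)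
  obtain ⟨x₀, hx₀⟩ := (hA A.frame.1).1 ((A.mem_iff _).2 ⟨0, by simp [Frame.pt]⟩)
  have hξ (i : Fin k) : ∃ x, (x, A.frame.2.1 i) ∈ V := (hAdir _).1
    ((A.mem_direction_iff _).2 ⟨Pi.single i 1, Matrix.single_one_vecMul _ _⟩)
  choose ξ hξ using hξ
  -- Lifting the directions of $A$ to $V$ gives an affine section $t\mapsto x_0+t\Xi$ of $U\to A$.
  let Ξ : Matrix (Fin k) (Fin n) (ZMod 2) := Matrix.of ξ
  have hΞ (t : BVec k) : (t ᵥ* Ξ, t ᵥ* A.frame.mat) ∈ V := by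
    have : (t ᵥ* Ξ, t ᵥ* A.frame.mat) = ∑ i, t i • (ξ i, A.frame.2.1 i) := by
      rw [Matrix.vecMul_eq_sum, Matrix.vecMul_eq_sum, Prod.ext_iff, Prod.fst_sum, Prod.snd_sum]
      exact ⟨rfl, rfl⟩
    rw [this]
    exact V.sum_mem fun i _ => V.smul_mem _ (hξ i)
  have hX (t : BVec k) : (x₀ + t ᵥ* Ξ, A.frame.pt t) ∈ U := by
    rw [hmemU _ hx₀, Frame.pt, Prod.mk_sub_mk, add_sub_cancel_left, add_sub_cancel_left]
    exact hΞ t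
  obtain ⟨d, hd⟩ := exists_eq_dotProduct (F.linear.comp
    ((Matrix.vecMulLinear Ξ).prod (Matrix.vecMulLinear A.frame.mat)))
  replace hd (t : BVec k) : F.linear (t ᵥ* Ξ, t ᵥ* A.frame.mat) = t ⬝ᵥ d := hd t
  -- $\gamma$ is the section read modulo $L$; $\delta$ is $F$ along the section plus the pairing of
  -- the section with the origin of $B$.
  let p : LocalData k := (σ, (Ξ * B.frame.matᵀ, B.frame.dual x₀),
    (d + Ξ *ᵥ B.frame.1, F (x₀, A.frame.1) + x₀ ⬝ᵥ B.frame.1))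
  have haff (t : BVec k) : p.aff t = B.frame.dual (x₀ + t ᵥ* Ξ) := by
    rw [Frame.dual_add, LocalData.aff, ← Matrix.vecMul_vecMul, Matrix.vecMul_transpose, add_comm]
    rfl
  have hdual (x : BVec n) : x ∈ L ↔ B.frame.dual x = 0 := by
    have key (t : BVec k) : B.frame.dual x ⬝ᵥ t = x ⬝ᵥ t ᵥ* B.frame.mat := by
      rw [Frame.dual, dotProduct_comm, dotProduct_mulVec, dotProduct_comm]
    rw [hLW]
    constructor
    · intro h
      refine dotProduct_eq_zero _ fun t => ?_
      rw [key]
      exact h _ (hBdir ▸ (B.mem_direction_iff _).2 ⟨t, rfl⟩)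
    · intro h w hw
      obtain ⟨t, rfl⟩ := (B.mem_direction_iff w).1 (hBdir ▸ hw)
      rw [← key, h, zero_dotProduct]
  have hpt (x : BVec n) (t : BVec k) : (x, A.frame.pt t) ∈ U ↔ B.frame.dual x = p.aff t := by
    rw [hmemU _ (hX t), Prod.mk_sub_mk, sub_self, ← hmemL, hdual, haff, ← sub_eq_zero (b := B.frame.dual _)]
    rw [Frame.dual, Frame.dual, Frame.dual, Matrix.mulVec_sub]
  have h2 : (2 : ZMod 2) = 0 := rfl
  have hform (t : BVec k) : p.form t = φ (A.frame.pt t) + p.aff t ⬝ᵥ σ t := by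
    have h1 := hF _ (hX t)
    have h3 := F.map_vadd (x₀, A.frame.1) (t ᵥ* Ξ, t ᵥ* A.frame.mat)
    rw [hd] at h3
    have h4 : (t ᵥ* Ξ, t ᵥ* A.frame.mat) +ᵥ (x₀, A.frame.1) = (x₀ + t ᵥ* Ξ, A.frame.pt t) := by
      rw [vadd_eq_add, Prod.mk_add_mk, add_comm, Frame.pt, add_comm A.frame.1]
    rw [h4, ← h1] at h3
    simp only [mmFun, ← hσ, Frame.dotProduct_pt, vadd_eq_add] at h3
    rw [← haff, add_dotProduct, ← dotProduct_mulVec] at h3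
    simp only [LocalData.form, p, dotProduct_add]
    linear_combination -h3 + h2 * (x₀ ⬝ᵥ B.frame.1 + t ⬝ᵥ Ξ *ᵥ B.frame.1)
  refine ⟨k, ⟨A, B, e, fun y => φ y, p.toFun, p, rfl⟩,
    Eq.symm ((eq_glue_iff _ _ _ _ _ _).2 ⟨fun x t => ?_, fun x y => ?_⟩)⟩
  · have : charFun (U : Set (BVec2 n)) (x, A.frame.pt t) =
        charFun {p.aff t} (B.frame.dual x) := by
      by_cases h : B.frame.dual x = p.aff t
      · rw [charFun_of_mem ((hpt x t).2 h), charFun_of_mem (by simp [h])]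
      · rw [charFun_of_notMem fun h' => h ((hpt x t).1 h'), charFun_of_notMem (by simp [h])]
    simp only [Pi.add_apply, mmFun, this, ← hσ, Frame.dotProduct_pt, LocalData.toFun, hform,
      add_dotProduct]
    rw [show p.1 = σ from rfl]
    linear_combination -h2 * (p.aff t ⬝ᵥ σ t)
  · rw [Pi.add_apply, charFun_of_notMem fun h => y.2 ((hA _).2 ⟨x, h⟩), add_zero]
    rfl

/-! ### Exact count -/

theorem mem_nearClass_iff {n : ℕ} (g : BoolFun2 n) : g ∈ nearClass (mmClass n) ↔
    ∃ D : (Σ k : Finset.Icc 2 n, GlueData k n), D.2.toFun = g := by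
  constructor
  · rintro ⟨h, hg⟩
    obtain ⟨f, ⟨π, φ, rfl⟩, U, hU, hF, rfl⟩ := Set.mem_iUnion₂.1 h
    obtain ⟨k, D, hD⟩ := exists_glueData π φ U hU hF
    have hk : 2 ≤ k := by
      by_contra hk
      exact hg (hD ▸ D.toFun_mem_mmClass (by omega))
    exact ⟨⟨⟨k, Finset.mem_Icc.2 ⟨hk, D.1.dimension_le⟩⟩, D⟩, hD⟩
  · rintro ⟨⟨⟨k, hk⟩, D⟩, rfl⟩
    exact D.toFun_mem_nearClass (Finset.mem_Icc.1 hk).1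

/-- For $U=\{y=0\}$, adding $\mathbf 1_U$ only changes $\varphi(0)$, and every function of the class
is affine on $U$. -/
lemma mmClass_subset_spClass (n : ℕ) : mmClass n ⊆ spClass (mmClass n) := by
  rintro _ ⟨π, φ, rfl⟩
  let U : AffineSubspace (ZMod 2) (BVec2 n) :=
    (LinearMap.ker (LinearMap.snd (ZMod 2) (BVec n) (BVec n))).toAffineSubspace
  have hmem (x y : BVec n) : (x, y) ∈ U ↔ y = 0 := Iff.rfl
  have h2 : (2 : ZMod 2) = 0 := rfl
  refine Set.mem_iUnion₂.2 ⟨mmFun π (φ + charFun {0}), ⟨_, _, rfl⟩, U, ⟨⟨0, (hmem 0 0).2 rfl⟩, ?_⟩,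
    ?_, ?_⟩
  · have := (LinearMap.snd (ZMod 2) (BVec n) (BVec n)).finrank_range_add_finrank_ker
    rw [LinearMap.range_eq_top.2 LinearMap.snd_surjective] at this
    rw [Submodule.toAffineSubspace_direction]
    simp at this
    omega
  · obtain ⟨F, hF⟩ : ∃ F : BVec2 n →ᵃ[ZMod 2] ZMod 2,
        ∀ x y, F (x, y) = π 0 ⬝ᵥ x + (φ 0 + charFun {0} (0 : BVec n)) :=
      ⟨((dotProductEquiv (ZMod 2) (Fin n) (π 0)).comp (LinearMap.fst _ _ _)).toAffineMap +
        AffineMap.const _ _ (φ 0 + charFun {0} (0 : BVec n)), fun x y => rfl⟩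
    refine ⟨F, ?_⟩
    rintro ⟨x, y⟩ hz
    obtain rfl := (hmem x y).1 hz
    rw [hF, dotProduct_comm]
    rfl
  · ext ⟨x, y⟩
    have : charFun (U : Set (BVec2 n)) (x, y) = charFun {0} y := by
      by_cases h : y = 0
      · rw [charFun_of_mem ((hmem x y).2 h), charFun_of_mem (by simp [h])]
      · rw [charFun_of_notMem fun h' => h ((hmem x y).1 h'), charFun_of_notMem (by simp [h])]
    simp only [Pi.add_apply, this, mmFun]
    linear_combination -h2 * (charFun {0} y)

lemma ncard_spClass (n : ℕ) : (spClass (mmClass n)).ncard =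
    (nearClass (mmClass n)).ncard + (mmClass n).ncard :=
  (Set.ncard_sdiff_add_ncard_of_subset (mmClass_subset_spClass n)).symm

lemma ncard_mmClass (n : ℕ) : (mmClass n).ncard = (2 ^ n).factorial * 2 ^ 2 ^ n := by
  have h : mmClass n = Set.range fun p : Equiv.Perm (BVec n) × (BVec n → ZMod 2) =>
      mmFun p.1 p.2 := by
    ext g
    constructor
    · rintro ⟨π, φ, rfl⟩
      exact ⟨(π, φ), rfl⟩
    · rintro ⟨p, rfl⟩
      exact ⟨_, _, rfl⟩
  have hinj : Function.Injective fun p : Equiv.Perm (BVec n) × (BVec n → ZMod 2) =>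
      mmFun p.1 p.2 := by
    rintro ⟨π, φ⟩ ⟨π', φ'⟩ heq
    have (y : BVec n) : π y = π' y ∧ φ y = φ' y :=
      dotProduct_left_injective fun x => congrFun heq (x, y)
    rw [show π = π' from Equiv.ext fun y => (this y).1, show φ = φ' from funext fun y => (this y).2]
  rw [h, ← Nat.card_coe_set_eq, Nat.card_range_of_injective hinj, Nat.card_prod, Nat.card_perm]
  simp

instance finite_localSet (k : ℕ) : Finite (localSet k) := Set.finite_range _

instance finite_glueData (k n : ℕ) : Finite (GlueData k n) :=
  inferInstanceAs (Finite (Σ A : Flat k n, Σ B : Flat k n,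
    ({y // y ∉ A.1} ≃ {y // y ∉ B.1}) × ({y // y ∉ A.1} → ZMod 2) × localSet k))

lemma card_glueData (k n : ℕ) : Nat.card (GlueData k n) =
    Nat.card (Flat k n) ^ 2 * ((2 ^ n - 2 ^ k).factorial * 2 ^ (2 ^ n - 2 ^ k) *
      Nat.card (localSet k)) := by
  classical
  have : Fintype (Flat k n) := Fintype.ofFinite _
  have hcompl (A : Flat k n) : Nat.card {y // y ∉ A.1} = 2 ^ n - 2 ^ k := by
    have h1 : Nat.card {y // y ∈ A.1} + Nat.card {y // y ∉ A.1} = Nat.card (BVec n) := by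
      rw [← Nat.card_sum]
      exact Nat.card_congr (Equiv.sumCompl _)
    rw [A.card_points] at h1
    simp only [Nat.card_eq_fintype_card (α := BVec n), Fintype.card_pi, ZMod.card,
      Finset.prod_const, Finset.card_univ, Fintype.card_fin] at h1
    omega
  have hequiv (A B : Flat k n) : Nat.card ({y // y ∉ A.1} ≃ {y // y ∉ B.1}) =
      (2 ^ n - 2 ^ k).factorial := by
    have e : {y // y ∉ A.1} ≃ {y // y ∉ B.1} :=
      (Finite.equivFinOfCardEq (hcompl A)).trans (Finite.equivFinOfCardEq (hcompl B)).symm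
    rw [← hcompl A, ← Nat.card_perm]
    exact Nat.card_congr (Equiv.equivCongr (Equiv.refl _) e.symm)
  have hfun (A : Flat k n) : Nat.card ({y // y ∉ A.1} → ZMod 2) = 2 ^ (2 ^ n - 2 ^ k) := by
    rw [Nat.card_fun, hcompl]; simp
  rw [GlueData, Nat.card_sigma]
  simp only [Nat.card_sigma, Nat.card_prod, hequiv, hfun, Finset.sum_const,
    Finset.card_univ, smul_eq_mul, ← Nat.card_eq_fintype_card]
  ring

theorem ncard_nearClass (n : ℕ) : (nearClass (mmClass n)).ncard =
    ∑ k ∈ Finset.Icc 2 n, Nat.card (Flat k n) ^ 2 *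
      ((2 ^ n - 2 ^ k).factorial * 2 ^ (2 ^ n - 2 ^ k) * Nat.card (localSet k)) := by
  have h : nearClass (mmClass n) =
      Set.range fun D : (Σ k : Finset.Icc 2 n, GlueData k n) => D.2.toFun :=
    Set.ext fun g => mem_nearClass_iff g
  rw [h, ← Nat.card_coe_set_eq, Nat.card_range_of_injective
    (glueData_toFun_injective n _ fun k hk => (Finset.mem_Icc.1 hk).1), Nat.card_sigma]
  simp only [card_glueData]
  exact Finset.sum_coe_sort (Finset.Icc 2 n) fun k => Nat.card (Flat k n) ^ 2 *
      ((2 ^ n - 2 ^ k).factorial * 2 ^ (2 ^ n - 2 ^ k) * Nat.card (localSet k))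

/-! ### Number of local functions -/

lemma card_matrix_prod_bVec (k : ℕ) :
    Nat.card ((Matrix (Fin k) (Fin k) (ZMod 2) × BVec k) × (BVec k × ZMod 2)) =
      2 ^ ((k + 1) ^ 2) := by
  have : Nat.card (Matrix (Fin k) (Fin k) (ZMod 2)) = 2 ^ (k * k) := by
    change Nat.card (Fin k → Fin k → ZMod 2) = _
    simp [pow_mul]
  rw [Nat.card_prod, Nat.card_prod, Nat.card_prod, this]
  simp only [Nat.card_eq_fintype_card, Fintype.card_pi, ZMod.card,
      Finset.prod_const, Finset.card_univ, Fintype.card_fin]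
  ring

lemma card_localData (k : ℕ) :
    Nat.card (LocalData k) = (2 ^ k).factorial * 2 ^ ((k + 1) ^ 2) := by
  rw [Nat.card_prod, card_matrix_prod_bVec, Nat.card_perm]
  simp

lemma card_localSet_le (k : ℕ) :
    Nat.card (localSet k) ≤ (2 ^ k).factorial * 2 ^ ((k + 1) ^ 2) :=
  (Finite.card_range_le _).trans (card_localData k).le

lemma LocalData.ext_of_aff_form {k : ℕ} {p q : LocalData k} (h1 : p.1 = q.1)
    (h2 : ∀ t, p.aff t = q.aff t) (h3 : ∀ t, p.form t = q.form t) : p = q := by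
  obtain ⟨σ, ⟨M, c⟩, d, d₀⟩ := p
  obtain ⟨σ', ⟨M', c'⟩, d', d₀'⟩ := q
  obtain rfl : σ = σ' := h1
  simp only [LocalData.aff] at h2
  simp only [LocalData.form] at h3
  obtain ⟨rfl, rfl⟩ := dotProduct_left_injective h3
  obtain rfl : c = c' := by simpa using h2 0
  obtain rfl : M = M' := Matrix.ext_of_single_vecMul fun i => add_right_cancel (h2 (Pi.single i 1))
  rfl

lemma LocalData.toFun_injective_three : Function.Injective (LocalData.toFun (k := 3)) := by
  intro p q h
  have h2 : (2 : ZMod 2) = 0 := rfl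
  have haff (t : BVec 3) : p.aff t = q.aff t := by
    by_contra hne
    -- In dimension three some plane through $0$ avoids $d$. Summing over its translate by
    -- $\gamma_p(t)$ sees the indicator of `p` but not that of `q`; in dimension two no such plane
    -- exists.
    have key : ∀ d : BVec 3, d ≠ 0 → ∃ u v : BVec 3,
        u ≠ 0 ∧ v ≠ 0 ∧ u + v ≠ 0 ∧ u ≠ d ∧ v ≠ d ∧ u + v ≠ d := by decide
    obtain ⟨u, v, hu, hv, huv, hud, hvd, huvd⟩ :=
      key (q.aff t - p.aff t) (sub_ne_zero.2 (Ne.symm hne))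
    have e (s : BVec 3) := congrFun (congrFun h s) t
    have e0 := e (p.aff t)
    have e1 := e (p.aff t + u)
    have e2 := e (p.aff t + v)
    have e3 := e (p.aff t + (u + v))
    simp only [LocalData.toFun] at e0 e1 e2 e3
    have hp {w : BVec 3} (hw : w ≠ 0) : charFun {p.aff t} (p.aff t + w) = 0 :=
      charFun_of_notMem (by simpa using hw)
    have hq {w : BVec 3} (hw : w ≠ q.aff t - p.aff t) : charFun {q.aff t} (p.aff t + w) = 0 :=
      charFun_of_notMem fun h' => hw (eq_sub_of_add_eq' h')
    rw [charFun_of_mem (Set.mem_singleton _), charFun_of_notMem (by simpa using hne)] at e0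
    rw [hp hu, hq hud] at e1
    rw [hp hv, hq hvd] at e2
    rw [hp huv, hq huvd] at e3
    simp only [add_dotProduct] at e0 e1 e2 e3
    have : (1 : ZMod 2) = 0 := by
      linear_combination e0 + e1 + e2 + e3 + h2 * (2 * p.aff t ⬝ᵥ q.1 t + 2 * q.aff t ⬝ᵥ q.1 t +
        2 * q.form t + u ⬝ᵥ q.1 t + v ⬝ᵥ q.1 t - u ⬝ᵥ p.1 t - v ⬝ᵥ p.1 t
        - 4 * p.aff t ⬝ᵥ p.1 t - 2 * p.form t)
    exact one_ne_zero this
  have hrest (t : BVec 3) : p.1 t = q.1 t ∧ p.form t = q.form t := by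
    have := dotProduct_left_injective (p := p.1 t) (q := q.1 t)
      (c := p.aff t ⬝ᵥ p.1 t + p.form t) (d := p.aff t ⬝ᵥ q.1 t + q.form t) fun s => by
        have := congrFun (congrFun h s) t
        simp only [LocalData.toFun, haff, add_dotProduct] at this ⊢
        linear_combination this
    refine ⟨this.1, ?_⟩
    have h' := this.2
    rw [this.1] at h'
    exact add_left_cancel h'
  exact LocalData.ext_of_aff_form (Equiv.ext fun t => (hrest t).1) haff fun t => (hrest t).2

lemma card_localSet_three : Nat.card (localSet 3) = (2 ^ 3).factorial * 2 ^ 16 := by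
  rw [localSet, Nat.card_range_of_injective LocalData.toFun_injective_three, card_localData]
  norm_num

lemma sum_bVec_two (f : BVec 2 → ZMod 2) :
    ∑ t, f t = f ![0, 0] + f ![1, 0] + f ![0, 1] + f ![1, 1] := by
  have : (Finset.univ : Finset (BVec 2)) = {![0, 0], ![1, 0], ![0, 1], ![1, 1]} := by decide
  rw [this, Finset.sum_insert (by decide), Finset.sum_insert (by decide),
    Finset.sum_insert (by decide), Finset.sum_singleton]
  ring

/-- In two variables the functions of even weight are affine. -/
lemma exists_affine_of_sum_eq_zero (f : BVec 2 → ZMod 2) (hf : ∑ t, f t = 0) :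
    ∃ d d₀, ∀ t : BVec 2, f t = t ⬝ᵥ d + d₀ := by
  rw [sum_bVec_two] at hf
  refine ⟨![f ![1, 0] + f ![0, 0], f ![0, 1] + f ![0, 0]], f ![0, 0], fun t => ?_⟩
  have ht : ∀ t : BVec 2, t = ![0, 0] ∨ t = ![1, 0] ∨ t = ![0, 1] ∨ t = ![1, 1] := by decide
  have h2 : (2 : ZMod 2) = 0 := rfl
  obtain rfl | rfl | rfl | rfl := ht t <;>
    simp only [dotProduct, Fin.sum_univ_two, Matrix.cons_val_zero, Matrix.cons_val_one]
  · ring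
  · linear_combination -h2 * f ![0, 0]
  · linear_combination -h2 * f ![0, 0]
  · linear_combination hf - h2 * (2 * f ![0, 0] + f ![1, 0] + f ![0, 1])

lemma charFun_singleton_two (a s : BVec 2) :
    charFun {a} s = (s 0 + a 0 + 1) * (s 1 + a 1 + 1) := by
  have key : ∀ a s : BVec 2,
      (if s = a then 1 else 0) = (s 0 + a 0 + 1) * (s 1 + a 1 + 1) := by decide
  rw [← key]
  split_ifs with h
  · exact charFun_of_mem h
  · exact charFun_of_notMem h

/-- In dimension two the permutation in local data can be taken to be the identity. -/
lemma LocalData.exists_toFun_one_eq (p : LocalData 2) :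
    ∃ a, LocalData.toFun (k := 2) (1, a) = p.toFun := by
  -- With $w=s+\gamma$, the local function is
  -- $(w_0+\sigma_1+1)(w_1+\sigma_0+1)+(\sigma_0+1)(\sigma_1+1)+\delta+1$. Replacing $\sigma$ by the
  -- identity is thus compensated in $\gamma$, with coordinates swapped, and in $\delta$. The
  -- corrections have even weight because $\sigma$ only permutes values, hence are affine.
  have hcoord (j : Fin 2) : ∃ d d₀, ∀ t : BVec 2, p.1 t j + t j = t ⬝ᵥ d + d₀ := by
    apply exists_affine_of_sum_eq_zero
    rw [Finset.sum_add_distrib, Equiv.sum_comp p.1 fun t => t j]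
    exact CharTwo.add_self_eq_zero _
  obtain ⟨d₁, c₁, h₁⟩ := hcoord 1
  obtain ⟨d₂, c₂, h₂⟩ := hcoord 0
  obtain ⟨d, d₀, hd⟩ := exists_affine_of_sum_eq_zero
    (fun t => (p.1 t 0 + 1) * (p.1 t 1 + 1) + (t 0 + 1) * (t 1 + 1)) (by
      rw [Finset.sum_add_distrib, Equiv.sum_comp p.1 fun t => (t 0 + 1) * (t 1 + 1)]
      exact CharTwo.add_self_eq_zero _)
  let M : Matrix (Fin 2) (Fin 2) (ZMod 2) := (Matrix.of ![d₁, d₂])ᵀ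
  let q : LocalData 2 := (1, (p.2.1.1 + M, p.2.1.2 + ![c₁, c₂]), (p.2.2.1 + d, p.2.2.2 + d₀))
  refine ⟨q.2, ?_⟩
  change q.toFun = p.toFun
  ext s t
  have hq0 : q.aff t 0 = p.aff t 0 + (p.1 t 1 + t 1) := by
    rw [h₁]
    change (t ᵥ* (p.2.1.1 + M) + (p.2.1.2 + ![c₁, c₂])) 0 = _
    rw [Matrix.vecMul_add]
    have : (t ᵥ* M) 0 = t ⬝ᵥ d₁ := rfl
    simp only [Pi.add_apply, this, LocalData.aff, Matrix.cons_val_zero]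
    ring
  have hq1 : q.aff t 1 = p.aff t 1 + (p.1 t 0 + t 0) := by
    rw [h₂]
    change (t ᵥ* (p.2.1.1 + M) + (p.2.1.2 + ![c₁, c₂])) 1 = _
    rw [Matrix.vecMul_add]
    have : (t ᵥ* M) 1 = t ⬝ᵥ d₂ := rfl
    simp only [Pi.add_apply, this, LocalData.aff, Matrix.cons_val_one, Matrix.cons_val_zero]
    ring
  have hqf : q.form t = p.form t + ((p.1 t 0 + 1) * (p.1 t 1 + 1) + (t 0 + 1) * (t 1 + 1)) := by
    rw [hd]
    simp only [LocalData.form, q, dotProduct_add]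
    ring
  have hq : q.1 t = t := rfl
  simp only [LocalData.toFun, charFun_singleton_two, dotProduct, Fin.sum_univ_two, Pi.add_apply,
    hq0, hq1, hqf, hq]
  generalize s 0 = a, s 1 = b, t 0 = u, t 1 = v, p.aff t 0 = x, p.aff t 1 = y, p.1 t 0 = z,
    p.1 t 1 = w, p.form t = r
  have h2 : (2 : ZMod 2) = 0 := rfl
  linear_combination h2 * (1 + a * u + x * u + w + w * u + w * z + v + 2 * v * u + v * b + v * y
    + v * z + u + z)

/-- With a common $\sigma$ the difference of two slices is a constant plus two indicators. A point
outside both supports shows that the constant is $0$, so the indicators agree. -/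
lemma LocalData.toFun_one_injective :
    Function.Injective fun a => LocalData.toFun (k := 2) (1, a) := by
  intro a b h
  change LocalData.toFun (k := 2) (1, a) = LocalData.toFun (k := 2) (1, b) at h
  set p : LocalData 2 := (1, a) with hp
  set q : LocalData 2 := (1, b) with hq
  have hpt (t : BVec 2) : p.1 t = t := rfl
  have hqt (t : BVec 2) : q.1 t = t := rfl
  have haff (t : BVec 2) : p.aff t = q.aff t := by
    by_contra hne
    have key : ∀ a b : BVec 2, ∃ s, s ≠ a ∧ s ≠ b := by decide
    obtain ⟨s, hs, hs'⟩ := key (p.aff t) (q.aff t)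
    have e0 := congrFun (congrFun h s) t
    have e1 := congrFun (congrFun h (p.aff t)) t
    simp only [LocalData.toFun, hpt, hqt] at e0 e1
    rw [charFun_of_notMem (by simpa using hs), charFun_of_notMem (by simpa using hs')] at e0
    rw [charFun_of_mem (by simp), charFun_of_notMem (by simpa using hne)] at e1
    simp only [add_dotProduct] at e0 e1
    have : (1 : ZMod 2) = 0 := by linear_combination e1 - e0
    exact one_ne_zero this
  have hform (t : BVec 2) : p.form t = q.form t := by
    have := congrFun (congrFun h 0) t
    simp only [LocalData.toFun, hpt, hqt, haff] at this
    linear_combination this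
  exact congrArg Prod.snd (LocalData.ext_of_aff_form (p := p) (q := q) rfl haff hform)

lemma card_localSet_two : Nat.card (localSet 2) = 512 := by
  have : localSet 2 = Set.range fun a => LocalData.toFun (k := 2) (1, a) := by
    apply Set.Subset.antisymm
    · rintro _ ⟨p, rfl⟩
      exact p.exists_toFun_one_eq
    · rintro _ ⟨a, rfl⟩
      exact ⟨_, rfl⟩
  rw [this, Nat.card_range_of_injective LocalData.toFun_one_injective, card_matrix_prod_bVec]
  norm_num

/-! ### Asymptotics -/

lemma card_flat_two {n : ℕ} (h : 2 ≤ n) :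
    (Nat.card (Flat 2 n) : ℝ) = 2 ^ n * (2 ^ n - 1) * (2 ^ n - 2) / 24 := by
  have h1 := card_flat_mul_card_frame 2 n
  rw [card_frame h, card_frame le_rfl] at h1
  simp only [Fin.prod_univ_two, Fin.val_zero, Fin.val_one, pow_zero, pow_one] at h1
  have h2 : 2 ^ 2 ≤ 2 ^ n := Nat.pow_le_pow_right (by norm_num) h
  have h3 := congrArg (Nat.cast (R := ℝ)) h1
  push_cast [Nat.cast_sub (show 1 ≤ 2 ^ n by omega), Nat.cast_sub (show 2 ≤ 2 ^ n by omega)] at h3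
  linear_combination h3 / 24

lemma card_flat_three {n : ℕ} (h : 3 ≤ n) :
    (Nat.card (Flat 3 n) : ℝ) = 2 ^ n * (2 ^ n - 1) * (2 ^ n - 2) * (2 ^ n - 4) / 1344 := by
  have h1 := card_flat_mul_card_frame 3 n
  rw [card_frame h, card_frame le_rfl] at h1
  simp only [Fin.prod_univ_three, Fin.val_zero, Fin.val_one, Fin.val_two, pow_zero, pow_one] at h1
  have h2 : 2 ^ 3 ≤ 2 ^ n := Nat.pow_le_pow_right (by norm_num) h
  have h3 := congrArg (Nat.cast (R := ℝ)) h1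
  push_cast [Nat.cast_sub (show 1 ≤ 2 ^ n by omega), Nat.cast_sub (show 2 ≤ 2 ^ n by omega),
    Nat.cast_sub (show 4 ≤ 2 ^ n by omega)] at h3
  linear_combination h3 / 1344

/-- Compare descending factorials factor by factor: $q(r-i)\le qr-i$. -/
lemma pow_le_choose_mul (q r : ℕ) (hq : 1 ≤ q) : q ^ r ≤ (q * r).choose r := by
  have h : q ^ r * r.factorial ≤ (q * r).choose r * r.factorial := by
    rw [mul_comm ((q * r).choose r), ← Nat.descFactorial_eq_factorial_mul_choose,
      ← Nat.descFactorial_self, Nat.descFactorial_eq_prod_range, Nat.descFactorial_eq_prod_range,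
      show q ^ r = ∏ _i ∈ Finset.range r, q by simp, ← Finset.prod_mul_distrib]
    refine Finset.prod_le_prod' fun i _ => ?_
    rw [Nat.mul_sub]
    exact Nat.sub_le_sub_left (Nat.le_mul_of_pos_left i hq) _
  exact Nat.le_of_mul_le_mul_right h r.factorial_pos

lemma three_mul_sq_le_two_pow {k : ℕ} (hk : 8 ≤ k) : 3 * k ^ 2 + 6 * k + 1 ≤ 2 ^ k := by
  induction k, hk using Nat.le_induction with
  | base => norm_num
  | succ k hk ih =>
    rw [pow_succ 2]
    nlinarith

/-- The left side collects flats, affine data and the desired saving $2^{2n}$; the right side comes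
from $\binom{2^n}{2^k}2^{2^k}$. The tightest case is $k=4$, reading $12n+25\le16n-48$, whence the
bound on $n$; for $k=3$ the slope $2^k$ is too small. -/
lemma exponent_le {k n : ℕ} (hk : 4 ≤ k) (hkn : k ≤ n) (hn : 20 ≤ n) :
    2 * n * (k + 1) + (k + 1) ^ 2 + 2 * n ≤ 2 ^ k * (n - k) + 2 ^ k := by
  obtain ⟨j, rfl⟩ := Nat.exists_eq_add_of_le hkn
  rw [Nat.add_sub_cancel_left]
  by_cases h8 : 8 ≤ k
  · have h1 := three_mul_sq_le_two_pow h8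
    have h2 : 2 * k + 4 ≤ 2 ^ k := by nlinarith
    nlinarith [Nat.mul_le_mul_right j h2]
  · interval_cases k <;> omega

/-- The number of functions glued along subspaces of dimension at least four is small. -/
lemma card_glueData_mul_le {k n : ℕ} (hk : 4 ≤ k) (hkn : k ≤ n) (hn : 20 ≤ n) :
    Nat.card (GlueData k n) * 2 ^ (2 * n) ≤ (mmClass n).ncard := by
  rw [card_glueData, ncard_mmClass]
  have hKN : 2 ^ k ≤ 2 ^ n := Nat.pow_le_pow_right (by norm_num) hkn
  have hchoose : 2 ^ (2 ^ k * (n - k)) ≤ (2 ^ n).choose (2 ^ k) := by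
    have := pow_le_choose_mul (2 ^ (n - k)) (2 ^ k) Nat.one_le_two_pow
    rwa [← pow_add, Nat.sub_add_cancel hkn, ← pow_mul, mul_comm (n - k)] at this
  have hfac := Nat.choose_mul_factorial_mul_factorial hKN
  have htwo : 2 ^ 2 ^ n = 2 ^ (2 ^ n - 2 ^ k) * 2 ^ 2 ^ k := by
    rw [← pow_add, Nat.sub_add_cancel hKN]
  calc Nat.card (Flat k n) ^ 2 * ((2 ^ n - 2 ^ k).factorial * 2 ^ (2 ^ n - 2 ^ k) *
        Nat.card (localSet k)) * 2 ^ (2 * n)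
      ≤ ((2 ^ n) ^ (k + 1)) ^ 2 * ((2 ^ n - 2 ^ k).factorial * 2 ^ (2 ^ n - 2 ^ k) *
        ((2 ^ k).factorial * 2 ^ ((k + 1) ^ 2))) * 2 ^ (2 * n) := by
        gcongr
        · exact card_flat_le k n
        · exact card_localSet_le k
    _ = (2 ^ n - 2 ^ k).factorial * (2 ^ k).factorial * 2 ^ (2 ^ n - 2 ^ k) *
        2 ^ (2 * n * (k + 1) + (k + 1) ^ 2 + 2 * n) := by ring
    _ ≤ (2 ^ n - 2 ^ k).factorial * (2 ^ k).factorial * 2 ^ (2 ^ n - 2 ^ k) *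
        2 ^ (2 ^ k * (n - k) + 2 ^ k) :=
        Nat.mul_le_mul_left _ (Nat.pow_le_pow_right (by norm_num) (exponent_le hk hkn hn))
    _ = 2 ^ (2 ^ k * (n - k)) * ((2 ^ k).factorial * (2 ^ n - 2 ^ k).factorial) *
        (2 ^ (2 ^ n - 2 ^ k) * 2 ^ 2 ^ k) := by ring
    _ ≤ (2 ^ n).choose (2 ^ k) * ((2 ^ k).factorial * (2 ^ n - 2 ^ k).factorial) *
        (2 ^ (2 ^ n - 2 ^ k) * 2 ^ 2 ^ k) := by gcongr
    _ = (2 ^ n).factorial * 2 ^ 2 ^ n := by rw [htwo, ← hfac]; ring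

lemma card_glueData_two {n : ℕ} (hn : 3 ≤ n) : (Nat.card (GlueData 2 n) : ℝ) =
    (1 / 18) * ((2 ^ n) ^ 2 + 2 + 6 / (2 ^ n - 3)) * (mmClass n).ncard := by
  have h8 : 2 ^ 3 ≤ 2 ^ n := Nat.pow_le_pow_right (by norm_num) hn
  rw [card_glueData, ncard_mmClass, card_localSet_two]
  push_cast
  rw [card_flat_two (by omega)]
  -- Writing $q=m+4$ lets $q!$ unfold down to $m!$; the quotient left is $q(q-1)(q-2)/(18(q-3))$.
  obtain ⟨m, hm⟩ : ∃ m, 2 ^ n = m + 4 := ⟨2 ^ n - 4, by omega⟩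
  have hm' : (2 ^ n : ℝ) = m + 4 := by exact_mod_cast hm
  have hsub : 2 ^ n - 4 = m := by omega
  rw [hsub, hm, hm']
  simp only [Nat.factorial_succ]
  push_cast
  have hm0 : (0 : ℝ) ≤ m := m.cast_nonneg
  have hne : (m : ℝ) + 4 - 3 ≠ 0 := by linarith
  field_simp
  ring

lemma card_glueData_three {n : ℕ} (hn : 3 ≤ n) : (Nat.card (GlueData 3 n) : ℝ) =
    (40 / 7) * ((1 + 3 / (2 ^ n - 3)) * (1 + 4 / (2 ^ n - 5)) * (1 + 4 / (2 ^ n - 6)) *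
      (1 + 3 / (2 ^ n - 7))) * (mmClass n).ncard := by
  have h8 : 2 ^ 3 ≤ 2 ^ n := Nat.pow_le_pow_right (by norm_num) hn
  rw [card_glueData, ncard_mmClass, card_localSet_three]
  push_cast
  rw [card_flat_three hn]
  obtain ⟨m, hm⟩ : ∃ m, 2 ^ n = m + 8 := ⟨2 ^ n - 8, by omega⟩
  have hm' : (2 ^ n : ℝ) = m + 8 := by exact_mod_cast hm
  have hsub : 2 ^ n - 8 = m := by omega
  have h8f : ((Nat.factorial 8 : ℕ) : ℝ) = 40320 := by norm_num [Nat.factorial]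
  rw [hsub, hm, hm', h8f]
  simp only [Nat.factorial_succ]
  push_cast
  have hm0 : (0 : ℝ) ≤ m := m.cast_nonneg
  have e3 : (m : ℝ) + 8 - 3 = m + 5 := by ring
  have e5 : (m : ℝ) + 8 - 5 = m + 3 := by ring
  have e6 : (m : ℝ) + 8 - 6 = m + 2 := by ring
  have e7 : (m : ℝ) + 8 - 7 = m + 1 := by ring
  rw [e3, e5, e6, e7]
  have h5 : (m : ℝ) + 5 ≠ 0 := by linarith
  have h3 : (m : ℝ) + 3 ≠ 0 := by linarith
  have h2 : (m : ℝ) + 2 ≠ 0 := by linarith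
  have h1 : (m : ℝ) + 1 ≠ 0 := by linarith
  field_simp
  ring

theorem ncard_nearClass_eq_sum {n : ℕ} : (nearClass (mmClass n)).ncard =
    ∑ k ∈ Finset.Icc 2 n, Nat.card (GlueData k n) := by
  simp only [card_glueData, ncard_nearClass]

/-- The error terms of the count, relative to the size of the Maiorana–McFarland class. -/
lemma exists_ncard_nearClass_eq {n : ℕ} (hn : 20 ≤ n) : ∃ r : ℝ, 0 ≤ r ∧ r ≤ ((2 : ℝ) ^ n)⁻¹ ∧
    ((nearClass (mmClass n)).ncard : ℝ) =
      ((1 / 18) * ((2 ^ n) ^ 2 + 2 + 6 / (2 ^ n - 3)) +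
        (40 / 7) * ((1 + 3 / (2 ^ n - 3)) * (1 + 4 / (2 ^ n - 5)) * (1 + 4 / (2 ^ n - 6)) *
          (1 + 3 / (2 ^ n - 7))) + r) * (mmClass n).ncard := by
  have hM : (0 : ℝ) < (mmClass n).ncard := by
    rw [ncard_mmClass]; positivity
  have hsplit : ∑ k ∈ Finset.Icc 2 n, Nat.card (GlueData k n) = Nat.card (GlueData 2 n) +
      (Nat.card (GlueData 3 n) + ∑ k ∈ Finset.Icc 4 n, Nat.card (GlueData k n)) := by
    rw [← Finset.add_sum_Ioc_eq_sum_Icc (by omega), ← Finset.Icc_succ_left_eq_Ioc,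
      ← Finset.add_sum_Ioc_eq_sum_Icc (by simp; omega), ← Finset.Icc_succ_left_eq_Ioc]
    rfl
  refine ⟨(∑ k ∈ Finset.Icc 4 n, Nat.card (GlueData k n) : ℕ) / (mmClass n).ncard,
    by positivity, ?_, ?_⟩
  · have h1 : (∑ k ∈ Finset.Icc 4 n, Nat.card (GlueData k n)) * 2 ^ (2 * n) ≤
        2 ^ n * (mmClass n).ncard := by
      rw [Finset.sum_mul]
      -- At most $2^n$ terms, each at most $2^{-2n}|\mathcal M_{2n}|$.
      refine (Finset.sum_le_card_nsmul _ _ _ fun k hk => ?_).trans (Nat.mul_le_mul_right _ ?_)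
      · exact card_glueData_mul_le (Finset.mem_Icc.1 hk).1 (Finset.mem_Icc.1 hk).2 hn
      · rw [Nat.card_Icc]
        have := n.lt_two_pow_self
        omega
    have h2 : ((∑ k ∈ Finset.Icc 4 n, Nat.card (GlueData k n) : ℕ) : ℝ) * 2 ^ (2 * n) ≤
        2 ^ n * (mmClass n).ncard := by exact_mod_cast h1
    rw [div_le_iff₀ hM, inv_mul_eq_div, le_div_iff₀ (by positivity)]
    have h3 : (0 : ℝ) < 2 ^ n := by positivity
    rw [two_mul, pow_add, ← mul_assoc, mul_comm ((2 : ℝ) ^ n)] at h2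
    exact le_of_mul_le_mul_right h2 h3
  · rw [ncard_nearClass_eq_sum, hsplit, Nat.cast_add, Nat.cast_add, card_glueData_two (by omega),
      card_glueData_three (by omega), add_mul _ _ ((mmClass n).ncard : ℝ), div_mul_cancel₀ _ hM.ne',
      add_mul]
    ring

lemma tendsto_const_div_two_pow_sub (c a : ℝ) :
    Tendsto (fun n : ℕ => c / (2 ^ n - a)) atTop (nhds 0) := by
  simp only [sub_eq_add_neg]
  exact (tendsto_atTop_add_const_right _ _
    (tendsto_pow_atTop_atTop_of_one_lt one_lt_two)).const_div_atTop c

theorem nearClass_isLittleO :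
    (fun n : ℕ => ((nearClass (mmClass n)).ncard : ℝ) -
        ((1 / 18 : ℝ) * 2 ^ (2 * n) + 367 / 63) * ((mmClass n).ncard : ℝ))
      =o[atTop] (fun n : ℕ => ((mmClass n).ncard : ℝ)) := by
  choose! r hr0 hr1 hr using fun n (hn : 20 ≤ n) => exists_ncard_nearClass_eq hn
  have hrlim : Tendsto r atTop (nhds 0) := by
    have hinv : Tendsto (fun n : ℕ => ((2 : ℝ) ^ n)⁻¹) atTop (nhds 0) :=
      tendsto_inv_atTop_zero.comp (tendsto_pow_atTop_atTop_of_one_lt one_lt_two)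
    refine tendsto_of_tendsto_of_tendsto_of_le_of_le' tendsto_const_nhds hinv ?_ ?_
    · filter_upwards [eventually_ge_atTop 20] with n hn using hr0 n hn
    · filter_upwards [eventually_ge_atTop 20] with n hn using hr1 n hn
  have hone (c a : ℝ) : Tendsto (fun n : ℕ => 1 + c / (2 ^ n - a)) atTop (nhds 1) := by
    simpa using (tendsto_const_div_two_pow_sub c a).const_add 1
  rw [isLittleO_iff_exists_eq_mul]
  refine ⟨fun n => (1 / 18) * (6 / (2 ^ n - 3)) + (40 / 7) * ((1 + 3 / (2 ^ n - 3)) *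
    (1 + 4 / (2 ^ n - 5)) * (1 + 4 / (2 ^ n - 6)) * (1 + 3 / (2 ^ n - 7)) - 1) + r n, ?_, ?_⟩
  · have h := ((tendsto_const_div_two_pow_sub 6 3).const_mul (1 / 18)).add
      ((((((hone 3 3).mul (hone 4 5)).mul (hone 4 6)).mul (hone 3 7)).sub_const 1).const_mul
        (40 / 7)) |>.add hrlim
    simpa using h
  · filter_upwards [eventually_ge_atTop 20] with n hn
    rw [hr n hn, Pi.mul_apply, mul_comm 2 n, pow_mul]
    ring

theorem spClass_isLittleO :
    (fun n : ℕ => ((spClass (mmClass n)).ncard : ℝ) -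
        ((1 / 18 : ℝ) * 2 ^ (2 * n) + 430 / 63) * ((mmClass n).ncard : ℝ))
      =o[atTop] (fun n : ℕ => ((mmClass n).ncard : ℝ)) := by
  refine nearClass_isLittleO.congr_left fun n => ?_
  rw [ncard_spClass]
  push_cast
  ring

end MaioranaMcFarland

theorem mainTheorem11 :
    ((fun n : ℕ =>
        ((MaioranaMcFarland.nearClass (MaioranaMcFarland.mmClass n)).ncard : ℝ)
          - ((1 / 18 : ℝ) * 2 ^ (2 * n) + 367 / 63)
            * ((MaioranaMcFarland.mmClass n).ncard : ℝ))
      =o[atTop] (fun n : ℕ => ((MaioranaMcFarland.mmClass n).ncard : ℝ)))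
    ∧
    ((fun n : ℕ =>
        ((MaioranaMcFarland.spClass (MaioranaMcFarland.mmClass n)).ncard : ℝ)
          - ((1 / 18 : ℝ) * 2 ^ (2 * n) + 430 / 63)
            * ((MaioranaMcFarland.mmClass n).ncard : ℝ))
      =o[atTop] (fun n : ℕ => ((MaioranaMcFarland.mmClass n).ncard : ℝ))) := by
  exact ⟨MaioranaMcFarland.nearClass_isLittleO, MaioranaMcFarland.spClass_isLittleO⟩
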